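/- Let $\mathbb{D}$ be the open unit disc, $\mathbb{T}$ the unit circle and $m$ normalised Lebesgue measure on $\mathbb{T}$. For $1\le p<\infty$ let $H^p(\mathbb{D})$ be the space of analytic functions $f$ on $\mathbb{D}$ with $$\|f\|^p=\sup_{0<r<1}\int_{\mathbb{T}}|f(rt)|^p\,dm(t)<\infty .$$ An operator $T$ on a normed space is called similar to an isometry if $T=S^{-1}US$ for some bounded invertible operator $S$ with bounded inverse and some linear isometry $U$ (not necessarily onto) of that space. An analytic map $\phi:\mathbb{D}\to\mathbb{D}$ is called inner if its radial limit $\lim_{r\to1^-}\phi(rt)$ exists and has modulus $1$ for $m$-almost every $t\in\mathbb{T}$. Proposition. Let $1\le p<\infty$, let $\phi:\mathbb{D}\to\mathbb{D}$ be (the restriction of) a rational function, and let $\psi:\mathbb{D}\to\mathbb{C}$ be such that $\psi\cdot(f\circ\phi)\in H^p(\mathbb{D})$ for every $f\in H^p(\mathbb{D})$, so that the weighted composition operator $W_{\phi,\psi}f=\psi\cdot(f\circ\phi)$ acts on $H^p(\mathbb{D})$. 1. If $W_{\phi,\psi}$ is similar to an isometry, then $\phi$ is inner. 2. More generally, if $W_{\phi,\psi}$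 is bounded below, that is, if there is $c>0$ with $\|W_{\phi,\psi}f\|\ge c\|f\|$ for all $f\in H^p(\mathbb{D})$, then $\phi$ is inner. -/

import Mathlib

open MeasureTheory Set Filter Topology Polynomial
open scoped ENNReal Complex.UnitDisc

noncomputable section

namespace HardyDisc

/-- Normalised Lebesgue measure on the unit circle, in the angle `θ ∈ (0, 2π]`. -/
def circleProb : Measure ℝ :=
  (ENNReal.ofReal (2 * Real.pi))⁻¹ • volume.restrict (Ioc 0 (2 * Real.pi))

/-- A function on the disc, extended by `0` to the plane (only its values on the disc matter). -/
def extendZero (f : 𝔻 → ℂ) (z : ℂ) : ℂ :=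
  if h : ‖z‖ < 1 then f (Complex.UnitDisc.mk z h) else 0

/-- `f` is analytic (holomorphic) on the open unit disc. -/
def AnalyticOnDisc (f : 𝔻 → ℂ) : Prop :=
  DifferentiableOn ℂ (extendZero f) (Metric.ball 0 1)

/-- The quantity `sup_{0 < r < 1} ∫ |f(r t)|^p dm(t)`, with values in `[0, ∞]`. -/
def hardyPow (p : ℝ) (f : 𝔻 → ℂ) : ℝ≥0∞ :=
  ⨆ r ∈ Ioo (0 : ℝ) 1, ∫⁻ θ, ‖extendZero f (circleMap 0 r θ)‖ₑ ^ p ∂circleProb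

/-- Membership in `H^p` of the disc: analytic, with `sup_{0 < r < 1} ∫ |f(r t)|^p dm(t) < ∞`. -/
def MemHardy (p : ℝ) (f : 𝔻 → ℂ) : Prop :=
  AnalyticOnDisc f ∧ hardyPow p f < ∞

theorem extendZero_add (f g : 𝔻 → ℂ) : extendZero (f + g) = extendZero f + extendZero g := by
  funext z
  by_cases h : ‖z‖ < 1 <;> simp [extendZero, h]

theorem extendZero_smul (c : ℂ) (f : 𝔻 → ℂ) : extendZero (c • f) = c • extendZero f := by
  funext z
  by_cases h : ‖z‖ < 1 <;> simp [extendZero, h]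

theorem extendZero_zero : extendZero 0 = 0 := by
  funext z
  by_cases h : ‖z‖ < 1 <;> simp [extendZero, h]

theorem extendZero_coe (f : 𝔻 → ℂ) (z : 𝔻) : extendZero f z = f z := by
  have h : ‖(z : ℂ)‖ < 1 := z.norm_lt_one
  simp only [extendZero, h, dif_pos]
  congr 1

theorem circleMap_mem {r : ℝ} (hr : r ∈ Ioo (0 : ℝ) 1) (θ : ℝ) :
    circleMap 0 r θ ∈ Metric.ball (0 : ℂ) 1 := by
  simp [abs_of_pos hr.1, hr.2]

theorem AnalyticOnDisc.continuous_circle {f : 𝔻 → ℂ} (hf : AnalyticOnDisc f) {r : ℝ}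
    (hr : r ∈ Ioo (0 : ℝ) 1) : Continuous fun θ => extendZero f (circleMap 0 r θ) :=
  hf.continuousOn.comp_continuous (continuous_circleMap 0 r) (circleMap_mem hr)

theorem hardyPow_zero {p : ℝ} (hp : 1 ≤ p) : hardyPow p 0 = 0 := by
  simp [hardyPow, extendZero_zero, ENNReal.zero_rpow_of_pos (zero_lt_one.trans_le hp)]

theorem hardyPow_smul {p : ℝ} (hp : 1 ≤ p) (c : ℂ) (f : 𝔻 → ℂ) :
    hardyPow p (c • f) = ‖c‖ₑ ^ p * hardyPow p f := by
  have hp0 : 0 ≤ p := zero_le_one.trans hp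
  have hc : ‖c‖ₑ ^ p ≠ ∞ := ENNReal.rpow_ne_top_of_nonneg hp0 enorm_ne_top
  simp only [hardyPow, ENNReal.mul_iSup, extendZero_smul, Pi.smul_apply, enorm_smul,
    ENNReal.mul_rpow_of_nonneg _ _ hp0, lintegral_const_mul' _ _ hc]

theorem hardyPow_add_le {p : ℝ} (hp : 1 ≤ p) {f g : 𝔻 → ℂ} (hf : AnalyticOnDisc f)
    (hg : AnalyticOnDisc g) :
    hardyPow p (f + g) ^ (1 / p) ≤ hardyPow p f ^ (1 / p) + hardyPow p g ^ (1 / p) := by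
  have hp0 : 0 < p := zero_lt_one.trans_le hp
  rw [one_div, ENNReal.rpow_inv_le_iff hp0]
  refine iSup₂_le fun r hr => ?_
  rw [← ENNReal.rpow_inv_le_iff hp0]
  have hF := (hf.continuous_circle hr).enorm.aemeasurable (μ := circleProb)
  have hG := (hg.continuous_circle hr).enorm.aemeasurable (μ := circleProb)
  have key := ENNReal.lintegral_Lp_add_le hF hG hp
  rw [one_div] at key
  refine le_trans ?_ (key.trans (add_le_add ?_ ?_))
  · gcongr with θ
    rw [extendZero_add]
    exact enorm_add_le _ _
  · gcongr
    exact le_iSup₂ (f := fun (r : ℝ) (_ : r ∈ Ioo (0 : ℝ) 1) =>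
      ∫⁻ θ, ‖extendZero f (circleMap 0 r θ)‖ₑ ^ p ∂circleProb) r hr
  · gcongr
    exact le_iSup₂ (f := fun (r : ℝ) (_ : r ∈ Ioo (0 : ℝ) 1) =>
      ∫⁻ θ, ‖extendZero g (circleMap 0 r θ)‖ₑ ^ p ∂circleProb) r hr

theorem eq_zero_of_hardyPow {p : ℝ} (hp : 1 ≤ p) {f : 𝔻 → ℂ} (hf : AnalyticOnDisc f)
    (h : hardyPow p f = 0) : f = 0 := by
  have hp0 : 0 < p := zero_lt_one.trans_le hp
  have hcirc : ∀ r ∈ Ioo (0 : ℝ) 1, ∀ θ ∈ Ioo 0 (2 * Real.pi),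
      extendZero f (circleMap 0 r θ) = 0 := by
    intro r hr
    simp only [hardyPow, ENNReal.iSup_eq_zero] at h
    have hc := hf.continuous_circle hr
    have h1 := h r hr
    have hm : Measurable fun θ => ‖extendZero f (circleMap 0 r θ)‖ₑ ^ p :=
      hc.enorm.measurable.pow_const p
    rw [lintegral_eq_zero_iff hm, circleProb, Measure.ae_ennreal_smul_measure_eq
      (ENNReal.inv_ne_zero.2 ENNReal.ofReal_ne_top)] at h1
    have h2 : (fun θ => extendZero f (circleMap 0 r θ)) =ᵐ[volume.restrict (Ioo 0 (2 * Real.pi))]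
        fun _ => 0 := by
      filter_upwards [ae_restrict_of_ae_restrict_of_subset Ioo_subset_Ioc_self h1] with θ hθ
      simpa [ENNReal.rpow_eq_zero_iff, hp0, hp0.le, hp0.not_gt] using hθ
    exact Measure.eqOn_open_of_ae_eq h2 isOpen_Ioo hc.continuousOn continuousOn_const
  have hE : EqOn (extendZero f) (fun _ => 0) (Metric.ball 0 1) := by
    have ha : AnalyticOnNhd ℂ (extendZero f) (Metric.ball 0 1) :=
      DifferentiableOn.analyticOnNhd hf Metric.isOpen_ball
    have hθ : (Real.pi : ℝ) ∈ Ioo 0 (2 * Real.pi) :=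
      ⟨Real.pi_pos, by linarith [Real.pi_pos]⟩
    refine ha.eqOn_of_preconnected_of_frequently_eq analyticOnNhd_const
      (convex_ball (0 : ℂ) 1).isPreconnected (z₀ := 0) (by simp) ?_
    have ht : Tendsto (fun r : ℝ => circleMap 0 r Real.pi) (𝓝[>] 0) (𝓝[≠] (0 : ℂ)) := by
      refine tendsto_nhdsWithin_iff.2 ⟨?_, ?_⟩
      · have : Continuous fun r : ℝ => circleMap 0 r Real.pi := by
          unfold circleMap
          fun_prop
        simpa [circleMap] using (this.tendsto 0).mono_left nhdsWithin_le_nhds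
      · filter_upwards [self_mem_nhdsWithin] with r hr
        exact circleMap_ne_center (ne_of_gt hr)
    refine ht.frequently (Eventually.frequently ?_)
    filter_upwards [Ioo_mem_nhdsGT (zero_lt_one : (0 : ℝ) < 1)] with r hr
    exact hcirc r hr _ hθ
  funext z
  rw [← extendZero_coe f z]
  exact hE (by simpa using z.norm_lt_one)

/-- `H^p` of the disc as a linear subspace of the space of all functions on the disc. -/
def hardySubmodule (p : ℝ) [hp : Fact (1 ≤ p)] : Submodule ℂ (𝔻 → ℂ) where
  carrier := {f | MemHardy p f}
  zero_mem' := by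
    refine ⟨?_, by rw [hardyPow_zero hp.out]; exact ENNReal.zero_lt_top⟩
    rw [AnalyticOnDisc, extendZero_zero]
    exact differentiableOn_const 0
  add_mem' := by
    intro f g hf hg
    have hp0 : 0 < p := zero_lt_one.trans_le hp.out
    have hi : 0 < 1 / p := by positivity
    refine ⟨?_, ?_⟩
    · rw [AnalyticOnDisc, extendZero_add]
      exact DifferentiableOn.add hf.1 hg.1
    · rw [← ENNReal.rpow_lt_top_iff_of_pos hi]
      refine (hardyPow_add_le hp.out hf.1 hg.1).trans_lt (ENNReal.add_lt_top.2 ⟨?_, ?_⟩)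
      · exact (ENNReal.rpow_lt_top_iff_of_pos hi).2 hf.2
      · exact (ENNReal.rpow_lt_top_iff_of_pos hi).2 hg.2
  smul_mem' := by
    intro c f hf
    have hp0 : 0 < p := zero_lt_one.trans_le hp.out
    refine ⟨?_, ?_⟩
    · rw [AnalyticOnDisc, extendZero_smul]
      exact DifferentiableOn.const_smul hf.1 c
    · rw [hardyPow_smul hp.out]
      exact ENNReal.mul_lt_top (ENNReal.rpow_lt_top_of_nonneg hp0.le enorm_ne_top) hf.2

/-- The Hardy space `H^p` of the unit disc, for real `1 ≤ p < ∞`. -/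
def HardySpace (p : ℝ) [Fact (1 ≤ p)] : Type := hardySubmodule p

namespace HardySpace

variable {p : ℝ} [hp : Fact (1 ≤ p)]

instance : AddCommGroup (HardySpace p) := inferInstanceAs (AddCommGroup (hardySubmodule p))

instance : Module ℂ (HardySpace p) := inferInstanceAs (Module ℂ (hardySubmodule p))

/-- The underlying function on the disc. -/
def toFun (f : HardySpace p) : 𝔻 → ℂ := f.1

instance : CoeFun (HardySpace p) fun _ => 𝔻 → ℂ := ⟨toFun⟩

/-- An element of `H^p` from a function on the disc that lies in `H^p`. -/
def ofMem (f : 𝔻 → ℂ) (hf : MemHardy p f) : HardySpace p := ⟨f, hf⟩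

theorem mem (f : HardySpace p) : MemHardy p f := f.2

/-- `‖f‖ = (sup_{0 < r < 1} ∫ |f(r t)|^p dm(t))^{1/p}`. -/
instance : Norm (HardySpace p) := ⟨fun f => (hardyPow p f).toReal ^ (1 / p)⟩

theorem norm_def (f : HardySpace p) : ‖f‖ = (hardyPow p f).toReal ^ (1 / p) := rfl

theorem normCore : NormedSpace.Core ℂ (HardySpace p) where
  norm_nonneg f := by rw [norm_def]; positivity
  norm_smul c f := by
    have hp0 : 0 < p := zero_lt_one.trans_le hp.out
    have h : hardyPow p (c • f : HardySpace p) = ‖c‖ₑ ^ p * hardyPow p f :=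
      hardyPow_smul hp.out c f
    rw [norm_def, norm_def, h, ENNReal.toReal_mul, ← ENNReal.toReal_rpow, toReal_enorm,
      Real.mul_rpow (by positivity) (by positivity), one_div,
      Real.rpow_rpow_inv (norm_nonneg c) hp0.ne']
  norm_triangle f g := by
    have hp0 : 0 < p := zero_lt_one.trans_le hp.out
    have hi : 0 < 1 / p := by positivity
    have hf := (ENNReal.rpow_lt_top_iff_of_pos hi).2 f.mem.2
    have hg := (ENNReal.rpow_lt_top_iff_of_pos hi).2 g.mem.2
    have h : hardyPow p (f + g : HardySpace p) ^ (1 / p) ≤ _ :=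
      hardyPow_add_le hp.out f.mem.1 g.mem.1
    have h' := ENNReal.toReal_mono (ENNReal.add_lt_top.2 ⟨hf, hg⟩).ne h
    rw [ENNReal.toReal_add hf.ne hg.ne] at h'
    simpa only [norm_def, ENNReal.toReal_rpow] using h'
  norm_eq_zero_iff f := by
    have hp0 : 0 < p := zero_lt_one.trans_le hp.out
    constructor
    · intro h
      rw [norm_def, Real.rpow_eq_zero ENNReal.toReal_nonneg (by positivity),
        ENNReal.toReal_eq_zero_iff] at h
      exact Subtype.ext (eq_zero_of_hardyPow hp.out f.mem.1 (h.resolve_right f.mem.2.ne))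
    · rintro rfl
      have h : hardyPow p (0 : HardySpace p) = 0 := hardyPow_zero hp.out
      rw [norm_def, h, ENNReal.toReal_zero, Real.zero_rpow (by positivity)]

instance : NormedAddCommGroup (HardySpace p) := NormedAddCommGroup.ofCore normCore

instance : NormedSpace ℂ (HardySpace p) := NormedSpace.ofCore normCore

end HardySpace

/-- `ψ · (f ∘ φ)` lies in `H^p` for every `f` in `H^p`, that is, the weighted composition
operator with symbol `φ` and weight `ψ` is an operator on `H^p` of the disc. -/
def ActsOnHardy (p : ℝ) (φ : 𝔻 → 𝔻) (ψ : 𝔻 → ℂ) : Prop :=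
  ∀ f : 𝔻 → ℂ, MemHardy p f → MemHardy p fun z => ψ z * f (φ z)

/-- The weighted composition operator `W f = ψ · (f ∘ φ)` on `H^p` of the disc. (It is
automatically bounded, by the closed graph theorem.) -/
def weightedComp {p : ℝ} [Fact (1 ≤ p)] (φ : 𝔻 → 𝔻) (ψ : 𝔻 → ℂ) (h : ActsOnHardy p φ ψ) :
    HardySpace p →ₗ[ℂ] HardySpace p where
  toFun f := HardySpace.ofMem (fun z => ψ z * f (φ z)) (h f f.mem)
  map_add' f g := Subtype.ext (funext fun z => mul_add (ψ z) (f (φ z)) (g (φ z)))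
  map_smul' c f := Subtype.ext (funext fun z => mul_left_comm (ψ z) c (f (φ z)))

/-- `T = S⁻¹ U S` with `S` an invertible bounded operator and `U` a linear isometry. -/
def IsSimilarToIsometry {E : Type*} [NormedAddCommGroup E] [NormedSpace ℂ E]
    (T : E →ₗ[ℂ] E) : Prop :=
  ∃ (S : E ≃L[ℂ] E) (U : E →ₗᵢ[ℂ] E), ∀ x, T x = S.symm (U (S x))

/-- `T` is bounded below: `c ‖x‖ ≤ ‖T x‖` for all `x`, for some `c > 0`. -/
def IsBoundedBelow {E : Type*} [NormedAddCommGroup E] [NormedSpace ℂ E]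
    (T : E →ₗ[ℂ] E) : Prop :=
  ∃ c : ℝ, 0 < c ∧ ∀ x, c * ‖x‖ ≤ ‖T x‖

/-- The self-map `φ` of the disc is (the restriction of) a rational function. -/
def IsRational (φ : 𝔻 → 𝔻) : Prop :=
  ∃ P Q : ℂ[X], ∀ z : 𝔻, Q.eval (z : ℂ) ≠ 0 ∧ (φ z : ℂ) = P.eval (z : ℂ) / Q.eval (z : ℂ)

/-- The self-map `φ` of the disc is inner: it is analytic, and at almost every point of the unit
circle its radial limit exists and has modulus `1`. -/
def IsInner (φ : 𝔻 → 𝔻) : Prop :=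
  AnalyticOnDisc (fun z => (φ z : ℂ)) ∧
    ∀ᵐ θ ∂circleProb, ∃ w : ℂ, ‖w‖ = 1 ∧
      Tendsto (fun r : ℝ => extendZero (fun z => (φ z : ℂ)) (circleMap 0 r θ)) (𝓝[<] 1) (𝓝 w)

end HardyDisc

end

namespace HardyDisc

/-! Similarity to an isometry gives a lower bound, so only the bounded-below case needs work. In
lowest terms `φ = P / Q` with `Q` zero-free on the closed disc, so `φ` is continuous there. On the
circle `|P|² - |Q|²` is, up to a power of `z`, a polynomial; hence either `|φ| = 1` on the whole
circle, and `φ` is inner, or `|φ| = 1` at finitely many points only.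

In the second case let `G` be a nonzero polynomial vanishing at the values of `φ` at those points,
and test the operator on `z ^ n * G`. The norms of these functions are at least the `L^p` norm of
`G` on the circle, for every `n`, whereas `φ ^ n * G ∘ φ` tends to `0` uniformly
(`exists_forall_norm_pow_mul_le`). Multiplying by `ψ ∈ H^p` gives images of arbitrarily small norm,
a contradiction. -/

theorem IsSimilarToIsometry.isBoundedBelow {E : Type*} [NormedAddCommGroup E] [NormedSpace ℂ E]
    {T : E →ₗ[ℂ] E} (h : IsSimilarToIsometry T) : IsBoundedBelow T := by
  obtain ⟨S, U, hT⟩ := h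
  have h1 : ∀ x, ‖x‖ ≤ ‖(S.symm : E →L[ℂ] E)‖ * ‖S x‖ := fun x => by
    simpa using (S.symm : E →L[ℂ] E).le_opNorm (S x)
  -- `S (T x) = U (S x)`, which has the norm of `S x`.
  have h2 : ∀ x, ‖S x‖ ≤ ‖(S : E →L[ℂ] E)‖ * ‖T x‖ := fun x => by
    simpa [hT] using (S : E →L[ℂ] E).le_opNorm (T x)
  set A := ‖(S.symm : E →L[ℂ] E)‖
  set B := ‖(S : E →L[ℂ] E)‖
  have hA : 0 ≤ A := norm_nonneg _
  have hB : 0 ≤ B := norm_nonneg _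
  -- The `+ 1` keeps the constant meaningful when `A * B = 0`, as on the trivial space.
  refine ⟨(A * B + 1)⁻¹, by positivity, fun x => ?_⟩
  rw [inv_mul_le_iff₀ (by positivity)]
  nlinarith [h1 x, mul_le_mul_of_nonneg_left (h2 x) hA, norm_nonneg (T x)]

/-! ### Polynomials and products in the Hardy norm -/

instance : IsFiniteMeasure circleProb := by
  refine ⟨?_⟩
  rw [circleProb, Measure.smul_apply, Measure.restrict_apply_univ, Real.volume_Ioc, smul_eq_mul]
  refine ENNReal.mul_lt_top (ENNReal.inv_lt_top.2 ?_) ENNReal.ofReal_lt_top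
  simpa using Real.pi_pos

theorem extendZero_of_mem_ball {f : 𝔻 → ℂ} {F : ℂ → ℂ} (h : ∀ z : 𝔻, f z = F z) {z : ℂ}
    (hz : z ∈ Metric.ball (0 : ℂ) 1) : extendZero f z = F z := by
  have hz' : ‖z‖ < 1 := by simpa using hz
  simp [extendZero, hz', h]

theorem AnalyticOnDisc.of_differentiableOn {f : 𝔻 → ℂ} {F : ℂ → ℂ} (h : ∀ z : 𝔻, f z = F z)
    (hF : DifferentiableOn ℂ F (Metric.ball 0 1)) : AnalyticOnDisc f :=
  hF.congr fun _ hz => extendZero_of_mem_ball h hz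

theorem memHardy_eval {p : ℝ} (hp : 0 ≤ p) (H : ℂ[X]) :
    MemHardy p fun z => H.eval (z : ℂ) := by
  refine ⟨.of_differentiableOn (fun _ => rfl) H.differentiable.differentiableOn, ?_⟩
  obtain ⟨C, hC⟩ := (isCompact_closedBall (0 : ℂ) 1).exists_bound_of_continuousOn
    H.continuous.continuousOn
  refine lt_of_le_of_lt (b := ∫⁻ _, ENNReal.ofReal C ^ p ∂circleProb)
    (iSup₂_le fun r hr => lintegral_mono fun θ => ?_) ?_
  · dsimp only
    gcongr
    have hz := circleMap_mem hr θ
    rw [extendZero_of_mem_ball (F := fun z => H.eval z) (fun _ => rfl) hz, ← ofReal_norm]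
    exact ENNReal.ofReal_le_ofReal (hC _ (Metric.ball_subset_closedBall hz))
  · rw [lintegral_const]
    exact ENNReal.mul_lt_top (ENNReal.rpow_lt_top_of_nonneg hp ENNReal.ofReal_ne_top)
      (measure_lt_top _ _)

/-- Fatou's lemma along radii increasing to `1`. -/
theorem lintegral_circle_le_hardyPow (p : ℝ) (H : ℂ[X]) :
    ∫⁻ θ, ‖H.eval (circleMap 0 1 θ)‖ₑ ^ p ∂circleProb ≤
      hardyPow p fun z => H.eval (z : ℂ) := by
  have hcont : Continuous fun x : ℝ × ℝ => ‖H.eval (circleMap 0 x.1 x.2)‖ₑ ^ p := by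
    have : Continuous fun x : ℝ × ℝ => circleMap 0 x.1 x.2 := by unfold circleMap; fun_prop
    exact (ENNReal.continuous_rpow_const).comp (H.continuous.comp this).enorm
  obtain ⟨u, -, hu, hlim⟩ := exists_seq_strictMono_tendsto' (zero_lt_one : (0 : ℝ) < 1)
  calc ∫⁻ θ, ‖H.eval (circleMap 0 1 θ)‖ₑ ^ p ∂circleProb
      = ∫⁻ θ, liminf (fun k => ‖H.eval (circleMap 0 (u k) θ)‖ₑ ^ p) atTop ∂circleProb := by
        refine lintegral_congr fun θ => (Tendsto.liminf_eq ?_).symm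
        exact (hcont.comp (Continuous.prodMk_left θ)).continuousAt.tendsto.comp hlim
    _ ≤ liminf (fun k => ∫⁻ θ, ‖H.eval (circleMap 0 (u k) θ)‖ₑ ^ p ∂circleProb) atTop :=
        lintegral_liminf_le fun k => (hcont.comp (Continuous.prodMk_right (u k))).measurable
    _ ≤ hardyPow p fun z => H.eval (z : ℂ) := by
        refine liminf_le_of_le (by isBoundedDefault) fun b hb => ?_
        obtain ⟨k, hk⟩ := hb.exists
        refine hk.trans (le_trans (le_of_eq (lintegral_congr fun θ => ?_))
          (le_iSup₂ (f := fun (r : ℝ) (_ : r ∈ Ioo (0 : ℝ) 1) =>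
            ∫⁻ θ, ‖extendZero (fun z => H.eval (z : ℂ)) (circleMap 0 r θ)‖ₑ ^ p ∂circleProb)
            (u k) (hu k)))
        rw [extendZero_of_mem_ball (F := fun z => H.eval z) (fun _ => rfl)
          (circleMap_mem (hu k) θ)]

/-- A vanishing integral would make the continuous integrand vanish on an arc, giving `G` infinitely
many roots. -/
theorem lintegral_circle_pos {p : ℝ} (hp : 0 < p) {G : ℂ[X]} (hG : G ≠ 0) :
    0 < ∫⁻ θ, ‖G.eval (circleMap 0 1 θ)‖ₑ ^ p ∂circleProb := by
  rw [pos_iff_ne_zero]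
  intro h
  have hm : Measurable fun θ => ‖G.eval (circleMap 0 1 θ)‖ₑ ^ p :=
    (G.continuous.comp (continuous_circleMap 0 1)).enorm.measurable.pow_const p
  rw [lintegral_eq_zero_iff hm, circleProb, Measure.ae_ennreal_smul_measure_eq
    (ENNReal.inv_ne_zero.2 ENNReal.ofReal_ne_top)] at h
  have h2 : (fun θ => G.eval (circleMap 0 1 θ)) =ᵐ[volume.restrict (Ioo 0 (2 * Real.pi))]
      fun _ => 0 := by
    filter_upwards [ae_restrict_of_ae_restrict_of_subset Ioo_subset_Ioc_self h] with θ hθ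
    simpa [ENNReal.rpow_eq_zero_iff, hp, hp.le, hp.not_gt] using hθ
  have h3 := Measure.eqOn_open_of_ae_eq h2 isOpen_Ioo
    (G.continuous.comp (continuous_circleMap 0 1)).continuousOn continuousOn_const
  have hinj : InjOn (circleMap 0 1) (Ioo 0 (2 * Real.pi)) := by
    exact (injOn_circleMap_of_abs_sub_le' one_ne_zero (by simp)).mono Ioo_subset_Ico_self
  refine hG (G.eq_zero_of_infinite_isRoot
    (((Ioo_infinite (by positivity)).image hinj).mono ?_))
  rintro _ ⟨θ, hθ, rfl⟩
  exact h3 hθ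

theorem hardyPow_mul_le {p : ℝ} (hp : 0 ≤ p) {ψ g : 𝔻 → ℂ} {ε : ℝ} (hg : ∀ z, ‖g z‖ ≤ ε) :
    hardyPow p (fun z => ψ z * g z) ≤ ENNReal.ofReal ε ^ p * hardyPow p ψ := by
  refine iSup₂_le fun r hr => ?_
  have hε : ENNReal.ofReal ε ^ p ≠ ∞ := ENNReal.rpow_ne_top_of_nonneg hp ENNReal.ofReal_ne_top
  calc ∫⁻ θ, ‖extendZero (fun z => ψ z * g z) (circleMap 0 r θ)‖ₑ ^ p ∂circleProb
      ≤ ∫⁻ θ, ENNReal.ofReal ε ^ p * ‖extendZero ψ (circleMap 0 r θ)‖ₑ ^ p ∂circleProb := by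
        refine lintegral_mono fun θ => ?_
        have hz : ‖circleMap 0 r θ‖ < 1 := by simpa using circleMap_mem hr θ
        simp only [extendZero, hz, dif_pos, enorm_mul]
        rw [← ENNReal.mul_rpow_of_nonneg _ _ hp, mul_comm]
        gcongr
        rw [← ofReal_norm]
        exact ENNReal.ofReal_le_ofReal (hg _)
    _ = ENNReal.ofReal ε ^ p *
        ∫⁻ θ, ‖extendZero ψ (circleMap 0 r θ)‖ₑ ^ p ∂circleProb := lintegral_const_mul' _ _ hε
    _ ≤ _ := by
        gcongr
        exact le_iSup₂ (f := fun (r : ℝ) (_ : r ∈ Ioo (0 : ℝ) 1) =>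
          ∫⁻ θ, ‖extendZero ψ (circleMap 0 r θ)‖ₑ ^ p ∂circleProb) r hr

/-! ### Rational self-maps and their modulus on the circle -/

/-- A rational self-map of the disc is a quotient of polynomials whose denominator has no zero
on the closed disc. -/
theorem IsRational.exists_closedBall {φ : 𝔻 → 𝔻} (hφ : IsRational φ) :
    ∃ P Q : ℂ[X], (∀ z ∈ Metric.closedBall (0 : ℂ) 1, Q.eval z ≠ 0 ∧ ‖P.eval z‖ ≤ ‖Q.eval z‖) ∧
      ∀ z : 𝔻, (φ z : ℂ) = P.eval (z : ℂ) / Q.eval (z : ℂ) := by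
  obtain ⟨P₀, Q₀, h⟩ := hφ
  have hQ₀ : Q₀ ≠ 0 := by
    rintro rfl
    exact (h 0).1 (by simp)
  obtain ⟨d, P, Q, hP, hQ, hc⟩ : ∃ d P Q : ℂ[X], P₀ = d * P ∧ Q₀ = d * Q ∧ IsCoprime P Q := by
    let _ := EuclideanDomain.gcdMonoid ℂ[X]
    have hd := gcd_ne_zero_of_right (a := P₀) hQ₀
    exact ⟨_, _, _, (EuclideanDomain.mul_div_cancel' hd (gcd_dvd_left P₀ Q₀)).symm,
      (EuclideanDomain.mul_div_cancel' hd (gcd_dvd_right P₀ Q₀)).symm,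
      isCoprime_div_gcd_div_gcd hQ₀⟩
  have hQz : ∀ z : 𝔻, Q.eval (z : ℂ) ≠ 0 := fun z hz => (h z).1 (by simp [hQ, hz])
  have hval : ∀ z : 𝔻, (φ z : ℂ) = P.eval (z : ℂ) / Q.eval (z : ℂ) := fun z => by
    have hd : d.eval (z : ℂ) ≠ 0 := fun hz => (h z).1 (by simp [hQ, hz])
    rw [(h z).2, hP, hQ, eval_mul, eval_mul, mul_div_mul_left _ _ hd]
  have hle : ∀ z ∈ Metric.closedBall (0 : ℂ) 1, ‖P.eval z‖ ≤ ‖Q.eval z‖ := by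
    rw [← closure_ball (0 : ℂ) one_ne_zero]
    refine fun z hz => le_on_closure (fun w hw => ?_) P.continuous.norm.continuousOn
      Q.continuous.norm.continuousOn hz
    have hw' : ‖w‖ < 1 := by simpa using hw
    have h1 := hval (Complex.UnitDisc.mk w hw')
    have h2 := (φ (Complex.UnitDisc.mk w hw')).norm_lt_one
    have h3 := hQz (Complex.UnitDisc.mk w hw')
    rw [h1, norm_div, div_lt_one (norm_pos_iff.2 h3)] at h2
    exact h2.le
  refine ⟨P, Q, fun z hz => ⟨fun hq => ?_, hle z hz⟩, hval⟩
  -- A zero of `Q` in the closed disc would also be a zero of `P`, against coprimality.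
  have hp : P.eval z = 0 := by simpa [hq] using hle z hz
  obtain ⟨a, b, hab⟩ := hc
  simpa [hp, hq] using congrArg (eval z) hab

/-- On the circle `conj z = z⁻¹`, so the conjugate of a polynomial becomes a polynomial after
multiplication by `z ^ N`. -/
theorem eval_reflect_map_conj {P : ℂ[X]} {N : ℕ} (hN : P.natDegree ≤ N) {z : ℂ} (hz : ‖z‖ = 1) :
    ((P.map (starRingEnd ℂ)).reflect N).eval z = z ^ N * starRingEnd ℂ (P.eval z) := by
  have hz0 : z ≠ 0 := norm_ne_zero_iff.1 (by simp [hz])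
  have hconj : starRingEnd ℂ z = z⁻¹ := (Complex.inv_eq_conj hz).symm
  have hd : (P.map (starRingEnd ℂ)).natDegree ≤ N := natDegree_map_le.trans hN
  let _ := invertibleOfNonzero (inv_ne_zero hz0)
  have h := eval₂_reflect_mul_pow (RingHom.id ℂ) z⁻¹ N (P.map (starRingEnd ℂ)) hd
  simp only [invOf_eq_inv, inv_inv, inv_pow, eval₂_id] at h
  rw [mul_inv_eq_iff_eq_mul₀ (pow_ne_zero _ hz0)] at h
  rw [h, mul_comm, ← hconj, eval_map_apply]

/-- Two polynomials have equal modulus at all points of the unit circle, or at finitely many. -/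
theorem finite_or_norm_eval_eq (P Q : ℂ[X]) :
    {z : ℂ | ‖z‖ = 1 ∧ ‖P.eval z‖ = ‖Q.eval z‖}.Finite ∨
      ∀ z : ℂ, ‖z‖ = 1 → ‖P.eval z‖ = ‖Q.eval z‖ := by
  obtain ⟨N, hP, hQ⟩ : ∃ N, P.natDegree ≤ N ∧ Q.natDegree ≤ N :=
    ⟨_, le_max_left _ _, le_max_right _ _⟩
  -- On the circle, `R = z ^ N * (|P|² - |Q|²)`.
  set R := P * (P.map (starRingEnd ℂ)).reflect N - Q * (Q.map (starRingEnd ℂ)).reflect N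
  have hR : ∀ z : ℂ, ‖z‖ = 1 → (R.eval z = 0 ↔ ‖P.eval z‖ = ‖Q.eval z‖) := fun z hz => by
    have hz0 : z ≠ 0 := norm_ne_zero_iff.1 (by simp [hz])
    have : R.eval z = z ^ N * ((‖P.eval z‖ ^ 2 - ‖Q.eval z‖ ^ 2 : ℝ) : ℂ) := by
      simp only [R, eval_sub, eval_mul, eval_reflect_map_conj hP hz,
        eval_reflect_map_conj hQ hz]
      push_cast
      rw [← Complex.mul_conj', ← Complex.mul_conj']
      ring
    rw [this, mul_eq_zero, or_iff_right (pow_ne_zero _ hz0), Complex.ofReal_eq_zero, sub_eq_zero,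
      sq_eq_sq₀ (norm_nonneg _) (norm_nonneg _)]
  by_cases h : R = 0
  · exact .inr fun z hz => (hR z hz).1 (by simp [h])
  · refine .inl (R.rootSet_finite ℂ |>.subset fun z hz => ?_)
    rw [mem_rootSet]
    exact ⟨h, by simpa using (hR z hz.1).2 hz.2⟩

/-- The quotient is continuous up to the circle, so every radial limit exists and is its boundary
value. -/
theorem isInner_of_norm_eval_eq {φ : 𝔻 → 𝔻} {P Q : ℂ[X]}
    (hQ : ∀ z ∈ Metric.closedBall (0 : ℂ) 1, Q.eval z ≠ 0)
    (hφ : ∀ z : 𝔻, (φ z : ℂ) = P.eval (z : ℂ) / Q.eval (z : ℂ))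
    (h : ∀ z : ℂ, ‖z‖ = 1 → ‖P.eval z‖ = ‖Q.eval z‖) : IsInner φ := by
  refine ⟨.of_differentiableOn hφ (P.differentiable.differentiableOn.fun_div
    Q.differentiable.differentiableOn fun z hz => hQ z (Metric.ball_subset_closedBall hz)),
    .of_forall fun θ => ?_⟩
  have hz : ‖circleMap 0 1 θ‖ = 1 := by simp
  have hq : Q.eval (circleMap 0 1 θ) ≠ 0 := hQ _ (by simp)
  refine ⟨P.eval (circleMap 0 1 θ) / Q.eval (circleMap 0 1 θ), ?_, ?_⟩
  · rw [norm_div, h _ hz, div_self (norm_ne_zero_iff.2 hq)]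
  · have hc : Continuous fun r : ℝ => circleMap 0 r θ := by unfold circleMap; fun_prop
    have ht : Tendsto (fun r : ℝ => P.eval (circleMap 0 r θ) / Q.eval (circleMap 0 r θ))
        (𝓝[<] 1) (𝓝 (P.eval (circleMap 0 1 θ) / Q.eval (circleMap 0 1 θ))) :=
      ((P.continuous.comp hc).continuousAt.div (Q.continuous.comp hc).continuousAt
        hq).tendsto.mono_left nhdsWithin_le_nhds
    refine ht.congr' ?_
    filter_upwards [Ioo_mem_nhdsLT (zero_lt_one : (0 : ℝ) < 1)] with r hr
    exact (extendZero_of_mem_ball (F := fun z => P.eval z / Q.eval z) hφ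
      (circleMap_mem hr θ)).symm

/-! ### Test functions and the contradiction -/

/-- If `φ` is continuous on a compact set, bounded by `1`, and `G` vanishes at its unimodular
values, then `φ ^ n * G ∘ φ` tends to `0` uniformly. -/
theorem exists_forall_norm_pow_mul_le {K : Set ℂ} (hK : IsCompact K) {φ : ℂ → ℂ}
    (hφ : ContinuousOn φ K) (h1 : ∀ z ∈ K, ‖φ z‖ ≤ 1) {G : ℂ[X]}
    (hG : ∀ z ∈ K, ‖φ z‖ = 1 → G.eval (φ z) = 0) {ε : ℝ} (hε : 0 < ε) :
    ∃ n : ℕ, ∀ z ∈ K, ‖(X ^ n * G).eval (φ z)‖ ≤ ε := by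
  have hu : TendstoUniformlyOn (fun (n : ℕ) z => ‖φ z‖ ^ n * ‖G.eval (φ z)‖) (fun _ => 0)
      atTop K := by
    -- Dini's theorem: the sequence decreases in `n` because `|φ| ≤ 1`.
    refine Antitone.tendstoUniformlyOn_of_forall_tendsto hK (fun n => ?_) (fun z hz => ?_)
      continuousOn_const fun z hz => ?_
    · exact (hφ.norm.pow n).mul (G.continuous.comp_continuousOn hφ).norm
    · intro m n hmn
      exact mul_le_mul_of_nonneg_right (pow_le_pow_of_le_one (norm_nonneg _) (h1 z hz) hmn)
        (norm_nonneg _)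
    · rcases (h1 z hz).lt_or_eq with h | h
      · simpa using (tendsto_pow_atTop_nhds_zero_of_lt_one (norm_nonneg _) h).mul_const
          ‖G.eval (φ z)‖
      · simp [hG z hz h]
  obtain ⟨n, hn⟩ := (Metric.tendstoUniformlyOn_iff.1 hu ε hε).exists
  refine ⟨n, fun z hz => ?_⟩
  have := hn z hz
  rw [dist_zero_left, Real.norm_eq_abs] at this
  simpa using ((le_abs_self _).trans this.le)

theorem isInner_of_isBoundedBelow {p : ℝ} [hp : Fact (1 ≤ p)] {φ : 𝔻 → 𝔻} (hφ : IsRational φ)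
    {ψ : 𝔻 → ℂ} (hW : ActsOnHardy p φ ψ) (hb : IsBoundedBelow (weightedComp φ ψ hW)) :
    IsInner φ := by
  have hp0 : 0 < p := zero_lt_one.trans_le hp.out
  obtain ⟨P, Q, hPQ, hval⟩ := hφ.exists_closedBall
  refine (finite_or_norm_eval_eq P Q).elim (fun hfin => ?_)
    (isInner_of_norm_eval_eq (fun z hz => (hPQ z hz).1) hval)
  exfalso
  obtain ⟨c, hc, hb⟩ := hb
  set Φ : ℂ → ℂ := fun z => P.eval z / Q.eval z
  set G : ℂ[X] := ∏ e ∈ hfin.toFinset, (X - C (Φ e)) with hGdef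
  have hG0 : G ≠ 0 := (monic_prod_of_monic _ _ fun _ _ => monic_X_sub_C _).ne_zero
  have hΦc : ContinuousOn Φ (Metric.closedBall 0 1) :=
    P.continuous.continuousOn.div Q.continuous.continuousOn fun z hz => (hPQ z hz).1
  have hΦ1 : ∀ z ∈ Metric.closedBall (0 : ℂ) 1, ‖Φ z‖ ≤ 1 := fun z hz => by
    rw [norm_div]
    exact div_le_one_of_le₀ (hPQ z hz).2 (norm_nonneg _)
  have hGz : ∀ z ∈ Metric.closedBall (0 : ℂ) 1, ‖Φ z‖ = 1 → G.eval (Φ z) = 0 := by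
    intro z hz h
    -- Inside the disc `|Φ| < 1`, so unimodular values occur only on the circle.
    have hz1 : ‖z‖ = 1 := by
      refine le_antisymm (by simpa using hz) (not_lt.1 fun hlt => ?_)
      have h2 := (φ (Complex.UnitDisc.mk z hlt)).norm_lt_one
      rw [hval] at h2
      exact h2.ne h
    rw [norm_div, div_eq_one_iff_eq (norm_ne_zero_iff.2 (hPQ z hz).1)] at h
    rw [hGdef, eval_prod]
    exact Finset.prod_eq_zero (hfin.mem_toFinset.2 ⟨hz1, h⟩) (by simp)
  -- `ψ` is the image of the constant function `1`.
  have hψ : MemHardy p ψ := by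
    simpa using hW _ (memHardy_eval hp0.le (1 : ℂ[X]))
  set I := ∫⁻ θ, ‖G.eval (circleMap 0 1 θ)‖ₑ ^ p ∂circleProb
  have hIpos : 0 < I := lintegral_circle_pos hp0 hG0
  have hItop : I < ∞ :=
    (lintegral_circle_le_hardyPow p G).trans_lt (memHardy_eval hp0.le G).2
  set a := I.toReal ^ (1 / p)
  have ha : 0 < a := Real.rpow_pos_of_pos (ENNReal.toReal_pos hIpos.ne' hItop.ne) _
  set M := (hardyPow p ψ).toReal ^ (1 / p)
  have hM : 0 ≤ M := by positivity
  -- Chosen so that `ε * M < c * a`, including when `M = 0`.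
  set ε := c * a / (M + 1)
  have hε : 0 < ε := by positivity
  obtain ⟨n, hn⟩ := exists_forall_norm_pow_mul_le (isCompact_closedBall (0 : ℂ) 1) hΦc hΦ1 hGz hε
  set f : HardySpace p := HardySpace.ofMem _ (memHardy_eval hp0.le (X ^ n * G))
  have hf : a ≤ ‖f‖ := by
    rw [HardySpace.norm_def]
    refine Real.rpow_le_rpow ENNReal.toReal_nonneg
      (ENNReal.toReal_mono f.mem.2.ne (le_trans (le_of_eq ?_)
        (lintegral_circle_le_hardyPow p (X ^ n * G)))) (by positivity)
    refine lintegral_congr fun θ => ?_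
    -- The factor `z ^ n` is unimodular on the circle, so the lower bound `a` does not depend on
    -- `n`.
    have h1 : ‖circleMap 0 1 θ‖ₑ = 1 := by simp [← ofReal_norm]
    rw [eval_mul, enorm_mul, eval_pow, eval_X, enorm_pow, h1, one_pow, one_mul]
  have hWf : ‖weightedComp φ ψ hW f‖ ≤ ε * M := by
    have h1 : hardyPow p (weightedComp φ ψ hW f) ≤ ENNReal.ofReal ε ^ p * hardyPow p ψ := by
      refine hardyPow_mul_le hp0.le fun z => ?_
      have := hn z (by simpa using z.norm_lt_one.le)
      rwa [show Φ z = φ z from (hval z).symm] at this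
    have htop : ENNReal.ofReal ε ^ p ≠ ∞ :=
      ENNReal.rpow_ne_top_of_nonneg hp0.le ENNReal.ofReal_ne_top
    have h2 := Real.rpow_le_rpow (z := 1 / p) ENNReal.toReal_nonneg
      (ENNReal.toReal_mono (ENNReal.mul_lt_top htop.lt_top hψ.2).ne h1) (by positivity)
    rw [HardySpace.norm_def]
    refine h2.trans_eq ?_
    rw [ENNReal.toReal_mul, ← ENNReal.toReal_rpow, ENNReal.toReal_ofReal hε.le,
      Real.mul_rpow (by positivity) (by positivity), one_div, Real.rpow_rpow_inv hε.le hp0.ne',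
      ← one_div]
  have hlt : ε * M < c * a := by
    have : ε * (M + 1) = c * a := div_mul_cancel₀ _ (by positivity)
    linarith
  have := (mul_le_mul_of_nonneg_left hf hc.le).trans ((hb f).trans hWf)
  linarith

end HardyDisc

theorem mainTheorem2 (p : ℝ) [Fact (1 ≤ p)] (φ : 𝔻 → 𝔻) (hφ : HardyDisc.IsRational φ)
    (ψ : 𝔻 → ℂ) (hW : HardyDisc.ActsOnHardy p φ ψ) :
    (HardyDisc.IsSimilarToIsometry (HardyDisc.weightedComp φ ψ hW) → HardyDisc.IsInner φ) ∧
      (HardyDisc.IsBoundedBelow (HardyDisc.weightedComp φ ψ hW) → HardyDisc.IsInner φ) :=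
  ⟨fun h => HardyDisc.isInner_of_isBoundedBelow hφ hW h.isBoundedBelow,
    fun h => HardyDisc.isInner_of_isBoundedBelow hφ hW h⟩
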